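/- Let $M$ be an $n$-dimensional complex manifold (a Hausdorff space with an atlas of charts to open subsets of $\mathbb C^n$ whose coordinate changes are holomorphic), let $\mathcal O_M$ be its sheaf of holomorphic functions, and let $k\ge 0$. For $p\in M$ let $(\wedge^kT^*)_p(M)$ be the space of continuous alternating $\mathbb C$-multilinear maps $T_p(M)^k\to\mathbb C$, and let $(\wedge^kT^*)(M)=\bigcup_{p}(\wedge^kT^*)_p(M)\to M$ be the holomorphic vector bundle they form, with the local trivializations induced by the charts of $M$. For $U\subset M$ open let $\Omega^k_M(U)$ be the $\mathcal O_M(U)$-module of holomorphic sections of this bundle over $U$. Then the sheaf of $\mathcal O_M$-modules $U\mapsto\Omega^k_M(U)$ is isomorphic, as a sheaf of $\mathcal O_M$-modules, to the classical sheaf of (germs of) holomorphic differential $k$-forms on $M$, i.e. of those sections $\omega$ of the exterior powers $\bigwedge^k (T_p(M))^*$, $p\in M$, of the cotangent spaces that in local holomorphic coordinates $(z^1,\dots,z^n)$ can be written as $\omega=\sum_{i_1<\dots<i_k} f_{i_1\dots i_k}\,dz^{i_1}\wedge\dots\wedge dz^{i_k}$ with holomorphic coefficients $f_{i_1\dots i_k}$.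 -/

import Mathlib

open scoped Manifold ContDiff

noncomputable section

namespace HolForms

open TopologicalSpace CategoryTheory Opposite

universe u

/-! ### Holomorphic maps on open subsets, and the structure sheaf

`M` is a manifold modelled on `ℂⁿ = Fin n → ℂ`; `MDifferentiable 𝓘(ℂ, Fin n → ℂ) I'` is complex
differentiability in charts, that is, holomorphy. -/

section Restriction

variable {n : ℕ} {M : Type u} [TopologicalSpace M] [ChartedSpace (Fin n → ℂ) M]
  {H' E' N : Type*} [NormedAddCommGroup E'] [NormedSpace ℂ E']
  [TopologicalSpace H'] {I' : ModelWithCorners ℂ E' H'} [TopologicalSpace N] [ChartedSpace H' N]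

/-- The restriction of a holomorphic map to a smaller open set is holomorphic. -/
theorem mdifferentiable_restrict {U V : Opens M} (h : U ≤ V) {f : V → N}
    (hf : MDifferentiable 𝓘(ℂ, Fin n → ℂ) I' f) :
    MDifferentiable 𝓘(ℂ, Fin n → ℂ) I' (fun x : U => f ⟨x.1, h x.2⟩) := fun x =>
  (differentiableWithinAt_localInvariantProp.liftPropAt_iff_comp_inclusion h f x).1
    (hf (Set.inclusion h x))

/-- A map that is holomorphic near every point is holomorphic. -/
theorem mdifferentiable_of_local {V : Opens M} {f : V → N}
    (hf : ∀ x : V, ∃ (U : Opens M) (h : U ≤ V), x.1 ∈ U ∧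
      MDifferentiable 𝓘(ℂ, Fin n → ℂ) I' (fun x : U => f ⟨x.1, h x.2⟩)) :
    MDifferentiable 𝓘(ℂ, Fin n → ℂ) I' f := by
  intro x
  obtain ⟨U, h, hx, hU⟩ := hf x
  exact (differentiableWithinAt_localInvariantProp.liftPropAt_iff_comp_inclusion h f ⟨x.1, hx⟩).2
    (hU ⟨x.1, hx⟩)

end Restriction

section StructureSheaf

variable (n : ℕ) (M : Type u) [TopologicalSpace M] [ChartedSpace (Fin n → ℂ) M]

/-- The ring `𝒪_M(U)` of holomorphic functions on an open subset `U` of `M`. -/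
def holRing (U : Opens M) : Subring (U → ℂ) where
  carrier := {f | MDifferentiable 𝓘(ℂ, Fin n → ℂ) 𝓘(ℂ, ℂ) f}
  mul_mem' hf hg := MDifferentiable.mul hf hg
  one_mem' := mdifferentiable_const
  add_mem' hf hg := MDifferentiable.add hf hg
  zero_mem' := mdifferentiable_const
  neg_mem' hf := MDifferentiable.neg hf

/-- Holomorphy of complex valued functions is a local condition. -/
def holFun : TopCat.LocalPredicate (X := TopCat.of M) (fun _ => ℂ) where
  pred {U} f := f ∈ holRing n M U
  res i _ hf := mdifferentiable_restrict i.le hf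
  locality {U} f hf := by
    refine mdifferentiable_of_local fun x => ?_
    obtain ⟨V, hx, i, hV⟩ := hf x
    exact ⟨V, i.le, hx, hV⟩

/-- The sheaf of rings `𝒪_M` of holomorphic functions on `M`. -/
def structureSheaf : TopCat.Sheaf RingCat.{u} (TopCat.of M) where
  obj :=
    { obj := fun U => RingCat.of (holRing n M (unop U))
      map := fun {U V} i => RingCat.ofHom
        { toFun := fun f => ⟨fun x => f.1 ⟨x.1, i.unop.le x.2⟩,
            mdifferentiable_restrict i.unop.le f.2⟩
          map_one' := rfl
          map_mul' := fun _ _ => rfl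
          map_zero' := rfl
          map_add' := fun _ _ => rfl }
      map_id := fun _ => rfl
      map_comp := fun _ _ => rfl }
  property := by
    rw [CategoryTheory.Presheaf.isSheaf_iff_isSheaf_forget _ _ (CategoryTheory.forget RingCat)]
    exact (TopCat.subsheafToTypes (holFun n M)).property

/-- The category of sheaves of `𝒪_M`-modules: Mathlib's, with its universe levels made explicit. -/
instance instCategoryModules : Category.{u, u + 1} (SheafOfModules.{u} (structureSheaf n M)) :=
  SheafOfModules.instCategory

/-! ### Sheaves of `𝒪_M`-modules consisting of dependent functions -/

/-- For a family `T x` of complex vector spaces indexed by `x : M`: for each open `U`, an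
`𝒪_M(U)`-submodule of `∏_{x ∈ U} T x`, stable under restriction and defined by a local condition. -/
structure LocalModule (T : M → Type) [∀ x, AddCommGroup (T x)] [∀ x, Module ℂ (T x)] where
  /-- the module of sections over `U` -/
  sec (U : Opens M) : Submodule (holRing n M U) ((x : U) → T x)
  res {U V : Opens M} (h : U ≤ V) {s : (x : V) → T x} (hs : s ∈ sec V) :
    (fun x : U => s ⟨x.1, h x.2⟩) ∈ sec U
  locality {V : Opens M} (s : (x : V) → T x)
    (hs : ∀ x : V, ∃ (U : Opens M) (h : U ≤ V), x.1 ∈ U ∧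
      (fun x : U => s ⟨x.1, h x.2⟩) ∈ sec U) : s ∈ sec V

variable {n M}
variable {T : M → Type} [∀ x, AddCommGroup (T x)] [∀ x, Module ℂ (T x)]

/-- The underlying presheaf of abelian groups, with restriction of functions. -/
def LocalModule.presheafAb (F : LocalModule n M T) : (Opens (TopCat.of M))ᵒᵖ ⥤ Ab.{u} where
  obj U := AddCommGrpCat.of (F.sec (unop U))
  map i := AddCommGrpCat.ofHom
    { toFun := fun s => ⟨fun x => s.1 ⟨x.1, i.unop.le x.2⟩, F.res i.unop.le s.2⟩
      map_zero' := rfl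
      map_add' := fun _ _ => rfl }
  map_id _ := rfl
  map_comp _ _ := rfl

instance LocalModule.instModulePresheafAb (F : LocalModule n M T) (U : (Opens (TopCat.of M))ᵒᵖ) :
    Module ((structureSheaf n M).obj.obj U) (F.presheafAb.obj U) :=
  inferInstanceAs (Module (holRing n M (unop U)) (F.sec (unop U)))

theorem LocalModule.isSheaf (F : LocalModule n M T) :
    Presheaf.IsSheaf (Opens.grothendieckTopology (TopCat.of M)) F.presheafAb := by
  rw [CategoryTheory.Presheaf.isSheaf_iff_isSheaf_forget _ _ (CategoryTheory.forget Ab)]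
  exact (TopCat.subsheafToTypes (X := TopCat.of M) (T := T)
      { pred := fun {U} s => s ∈ F.sec U
        res := fun i _ hs => F.res i.le hs
        locality := fun {U} s hs => F.locality s fun x => by
          obtain ⟨V, hx, i, hV⟩ := hs x
          exact ⟨V, i.le, hx, hV⟩ }).property

/-- The sheaf of `𝒪_M`-modules `U ↦ F.sec U`. -/
def LocalModule.toSheaf (F : LocalModule n M T) : SheafOfModules.{u} (structureSheaf n M) where
  val := PresheafOfModules.ofPresheaf F.presheafAb (fun _ _ _ _ _ => rfl)
  isSheaf := F.isSheaf

end StructureSheaf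

/-! ### The classical sheaf of holomorphic differential `k`-forms -/

section Classical

variable (n k : ℕ) (M : Type u) [TopologicalSpace M] [ChartedSpace (Fin n → ℂ) M]

/-- The `k`-th exterior power `⋀ᵏ (T_x M)*` of the holomorphic cotangent space at `x`. -/
def ExtFiber (x : M) : Type :=
  ⋀[ℂ]^k (Module.Dual ℂ (TangentSpace 𝓘(ℂ, Fin n → ℂ) x))

instance (x : M) : AddCommGroup (ExtFiber n k M x) :=
  inferInstanceAs (AddCommGroup (⋀[ℂ]^k (Module.Dual ℂ (TangentSpace 𝓘(ℂ, Fin n → ℂ) x))))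

instance (x : M) : Module ℂ (ExtFiber n k M x) :=
  inferInstanceAs (Module ℂ (⋀[ℂ]^k (Module.Dual ℂ (TangentSpace 𝓘(ℂ, Fin n → ℂ) x))))

variable {n k M}

/-- For a chart `e = (z¹, …, zⁿ)` of `M`, the differential `dzⁱ` at a point `x` of its domain. -/
def dz (e : OpenPartialHomeomorph M (Fin n → ℂ)) (i : Fin n) (x : M) :
    Module.Dual ℂ (TangentSpace 𝓘(ℂ, Fin n → ℂ) x) :=
  (mfderiv 𝓘(ℂ, Fin n → ℂ) 𝓘(ℂ, ℂ) (fun y => e y i) x :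
    TangentSpace 𝓘(ℂ, Fin n → ℂ) x →L[ℂ] ℂ).toLinearMap

/-- `dz^{i₁} ∧ ⋯ ∧ dz^{i_k}` at `x`, for a multi-index `i₁ < ⋯ < i_k`. -/
def dzWedge (e : OpenPartialHomeomorph M (Fin n → ℂ)) (I : Fin k ↪o Fin n) (x : M) :
    ExtFiber n k M x :=
  exteriorPower.ιMulti ℂ k (fun j => dz e (I j) x)

/-- `s` is a holomorphic differential `k`-form on `U`: in every local coordinate system
`(z¹, …, zⁿ)`, it can be written locally as `∑_{i₁ < ⋯ < i_k} f_I dz^{i₁} ∧ ⋯ ∧ dz^{i_k}` with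
holomorphic coefficients `f_I`. -/
def IsHolForm {U : Opens M} (s : (x : U) → ExtFiber n k M x) : Prop :=
  ∀ e ∈ atlas (Fin n → ℂ) M, ∀ p : U, (p : M) ∈ e.source →
    ∃ (V : Opens M) (hV : V ≤ U), (p : M) ∈ V ∧ (V : Set M) ⊆ e.source ∧
      ∃ f : (Fin k ↪o Fin n) → holRing n M V,
        ∀ x : V, s ⟨x, hV x.2⟩ = ∑ I, (f I).1 x • dzWedge e I (x : M)

variable (n k M)

/-- The modules of holomorphic differential `k`-forms on the open subsets of `M`. -/
def holForms : LocalModule n M (ExtFiber n k M) where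
  sec U :=
    { carrier := {s | IsHolForm s}
      add_mem' := by
        intro s t hs ht e he p hp
        obtain ⟨V, hV, hpV, hVe, f, hf⟩ := hs e he p hp
        obtain ⟨W, hW, hpW, hWe, g, hg⟩ := ht e he p hp
        refine ⟨V ⊓ W, inf_le_left.trans hV, ⟨hpV, hpW⟩, fun x hx => hVe hx.1, fun I =>
          ⟨fun x => (f I).1 ⟨x, x.2.1⟩ + (g I).1 ⟨x, x.2.2⟩,
            (mdifferentiable_restrict inf_le_left (f I).2).add
              (mdifferentiable_restrict inf_le_right (g I).2)⟩, fun x => ?_⟩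
        simp only [add_smul, Finset.sum_add_distrib]
        rw [← hf ⟨x, x.2.1⟩, ← hg ⟨x, x.2.2⟩]
        rfl
      zero_mem' := by
        intro e he p hp
        refine ⟨U ⊓ ⟨e.source, e.open_source⟩, inf_le_left, ⟨p.2, hp⟩, fun x hx => hx.2,
          fun I => 0, fun x => ?_⟩
        exact (Finset.sum_eq_zero fun I _ => zero_smul ℂ _).symm
      smul_mem' := by
        rintro h s hs e he p hp
        obtain ⟨V, hV, hpV, hVe, f, hf⟩ := hs e he p hp
        refine ⟨V, hV, hpV, hVe, fun I =>
          ⟨fun x => h.1 ⟨x, hV x.2⟩, mdifferentiable_restrict hV h.2⟩ * f I, fun x => ?_⟩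
        have : (h • s) ⟨x, hV x.2⟩ = h.1 ⟨x, hV x.2⟩ • s ⟨x, hV x.2⟩ := rfl
        rw [this, hf x, Finset.smul_sum]
        refine Finset.sum_congr rfl fun I _ => ?_
        rw [smul_smul]
        rfl }
  res {U V} h s hs e he p hp := by
    obtain ⟨W, hW, hpW, hWe, f, hf⟩ := hs e he ⟨p, h p.2⟩ hp
    refine ⟨U ⊓ W, inf_le_left, ⟨p.2, hpW⟩, fun x hx => hWe hx.2, fun I =>
      ⟨fun x => (f I).1 ⟨x, x.2.2⟩, mdifferentiable_restrict inf_le_right (f I).2⟩,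
      fun x => hf ⟨x, x.2.2⟩⟩
  locality {V} s hs e he p hp := by
    obtain ⟨U, h, hpU, hU⟩ := hs p
    obtain ⟨W, hW, hpW, hWe, f, hf⟩ := hU e he ⟨p, hpU⟩ hp
    exact ⟨W, hW.trans h, hpW, hWe, f, hf⟩

/-- The classical sheaf of `𝒪_M`-modules of (germs of) holomorphic differential `k`-forms. -/
def classicalFormSheaf : SheafOfModules.{u} (structureSheaf n M) :=
  (holForms n k M).toSheaf

end Classical

/-! ### Holomorphic sections of the bundle of continuous alternating `k`-forms -/

section Alternating

variable (n k : ℕ) (M : Type u) [TopologicalSpace M] [ChartedSpace (Fin n → ℂ) M]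

/-- The space of continuous alternating `ℂ`-multilinear `k`-forms on `T_x M`. -/
abbrev AltFiber (x : M) : Type :=
  TangentSpace 𝓘(ℂ, Fin n → ℂ) x [⋀^Fin k]→L[ℂ] Bundle.Trivial M ℂ x

/-- The model fibre: continuous alternating `k`-forms on `ℂⁿ`, with the operator norm. -/
abbrev AltModel : Type := (Fin n → ℂ) [⋀^Fin k]→L[ℂ] ℂ

/-- The total space of the bundle of continuous alternating `k`-forms. Topology, vector bundle
structure and charts come from Mathlib: a chart of `M` trivializes the tangent bundle, hence this
bundle, by pulling back forms. -/
abbrev AltBundle : Type u := Bundle.TotalSpace (AltModel n k) (AltFiber n k M)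

variable [IsManifold 𝓘(ℂ, Fin n → ℂ) ω M]

variable {n k M}

/-- `s` is a holomorphic section over `U`: it is holomorphic as a map from `U` to the total
space. -/
def IsHolSection {U : Opens M} (s : (x : U) → AltFiber n k M x) : Prop :=
  MDifferentiable 𝓘(ℂ, Fin n → ℂ) (𝓘(ℂ, Fin n → ℂ).prod 𝓘(ℂ, AltModel n k))
    (fun x : U => (Bundle.TotalSpace.mk' (AltModel n k) (x : M) (s x) : AltBundle n k M))

theorem isHolSection_iff {U : Opens M} (s : (x : U) → AltFiber n k M x) :
    IsHolSection s ↔ ∀ x₀ : U, MDifferentiableAt 𝓘(ℂ, Fin n → ℂ) 𝓘(ℂ, AltModel n k)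
      (fun x : U => ((trivializationAt (AltModel n k) (AltFiber n k M) (x₀ : M))
        ⟨(x : M), s x⟩).2) x₀ := by
  refine forall_congr' fun x₀ => ?_
  rw [mdifferentiableAt_totalSpace]
  refine and_iff_right ?_
  exact (contMDiff_subtype_val (n := 1) x₀).mdifferentiableAt one_ne_zero

theorem eventually_mem_base {U : Opens M} (x₀ : U) :
    ∀ᶠ x : U in nhds x₀,
      (x : M) ∈ (trivializationAt (AltModel n k) (AltFiber n k M) (x₀ : M)).baseSet :=
  continuous_subtype_val.continuousAt.eventually_mem
    ((trivializationAt (AltModel n k) (AltFiber n k M) (x₀ : M)).open_baseSet.mem_nhds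
      (FiberBundle.mem_baseSet_trivializationAt' _))

variable (n k M)

/-- The modules of holomorphic sections over the open subsets of `M`. -/
def altForms : LocalModule n M (AltFiber n k M) where
  sec U :=
    { carrier := {s | IsHolSection s}
      add_mem' := by
        intro s t hs ht
        simp only [Set.mem_ofPred_eq, isHolSection_iff] at hs ht ⊢
        intro x₀
        refine ((hs x₀).add (ht x₀)).congr_of_eventuallyEq ?_
        filter_upwards [eventually_mem_base (n := n) (k := k) x₀] with x hx
        exact ((trivializationAt (AltModel n k) (AltFiber n k M) (x₀ : M)).linear ℂ hx).map_add _ _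
      zero_mem' := by
        simp only [Set.mem_ofPred_eq, isHolSection_iff]
        intro x₀
        refine (mdifferentiableAt_const (c := (0 : AltModel n k))).congr_of_eventuallyEq ?_
        filter_upwards [eventually_mem_base (n := n) (k := k) x₀] with x hx
        exact ((trivializationAt (AltModel n k) (AltFiber n k M) (x₀ : M)).linear ℂ hx).map_zero
      smul_mem' := by
        rintro ⟨f, hf⟩ s hs
        simp only [Set.mem_ofPred_eq, isHolSection_iff] at hs ⊢
        intro x₀
        refine ((hf x₀).smul (hs x₀)).congr_of_eventuallyEq ?_
        filter_upwards [eventually_mem_base (n := n) (k := k) x₀] with x hx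
        exact ((trivializationAt (AltModel n k) (AltFiber n k M) (x₀ : M)).linear ℂ hx).map_smul
          (f x) (s x) }
  res h _ hs := mdifferentiable_restrict h hs
  locality _ hs := mdifferentiable_of_local hs

/-- The sheaf of `𝒪_M`-modules `U ↦ Ωᵏ_M(U)` of holomorphic sections of the bundle of continuous
alternating `k`-forms on the tangent spaces. -/
def altFormSheaf : SheafOfModules.{u} (structureSheaf n M) :=
  (altForms n k M).toSheaf

end Alternating

end HolForms

end

open scoped Manifold ContDiff

noncomputable section

namespace HolForms

open TopologicalSpace CategoryTheory Opposite

universe u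

/-! ### Exterior powers of the dual space and continuous alternating forms -/

section Algebra

/-! For a finite-dimensional `V` the pairing sending `φ₁ ∧ ⋯ ∧ φ_k` to `det (φⱼ(vᵢ))` is a canonical
isomorphism from `⋀ᵏ V*` to the alternating `k`-forms on `V` (`wedgeToAlternating_bijective`).
Applied at each point it is linear over functions and commutes with restriction, so it suffices that
it matches the two notions of holomorphic section. From the bundle to the classical side: the
coefficients of a form in a chart are its values on the coordinate fields `∂/∂zⁱ`, and these fields
are holomorphic in the trivialization of any other chart (`IsHolForm.of_isHolSection`). Conversely,
each `dz^{i₁} ∧ ⋯ ∧ dz^{i_k}` is constant in the trivialization of its own chart, so combinations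
with holomorphic coefficients are holomorphic there (`IsHolForm.isHolSection`). -/

/-- Alternating forms agreeing on increasing families of basis vectors are equal. -/
theorem alternating_ext_basis {𝕜 V ι : Type*} [NontriviallyNormedField 𝕜] [AddCommGroup V]
    [Module 𝕜 V] [TopologicalSpace V] [LinearOrder ι] {k : ℕ} (b : Module.Basis ι 𝕜 V)
    {f g : V [⋀^Fin k]→L[𝕜] 𝕜}
    (h : ∀ I : Fin k ↪o ι, f (fun j => b (I j)) = g (fun j => b (I j))) : f = g := by
  apply ContinuousAlternatingMap.toAlternatingMap_injective
  apply exteriorPower.alternatingMapLinearEquiv.injective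
  refine (b.exteriorPower k).ext fun s => ?_
  rw [exteriorPower.basis_apply, exteriorPower.ιMulti_family]
  simpa [Function.comp_def] using h (Set.powersetCard.ofFinEmbEquiv.symm s)

variable {𝕜 V : Type*} [NontriviallyNormedField 𝕜] [CompleteSpace 𝕜]
  [AddCommGroup V] [Module 𝕜 V] [TopologicalSpace V] [IsTopologicalAddGroup V]
  [ContinuousSMul 𝕜 V] [T2Space V] [FiniteDimensional 𝕜 V] {k : ℕ}

/-- Decomposable elements span the exterior power; on them the pairing is a determinant of linear
functionals, which are continuous in finite dimension. -/
theorem continuous_pairingDual (w : ⋀[𝕜]^k (Module.Dual 𝕜 V)) :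
    Continuous fun v : Fin k → V =>
      exteriorPower.pairingDual 𝕜 V k w (exteriorPower.ιMulti 𝕜 k v) := by
  have hw : w ∈ Submodule.span 𝕜 (Set.range (exteriorPower.ιMulti 𝕜 k)) := by
    rw [exteriorPower.ιMulti_span]
    trivial
  induction hw using Submodule.span_induction with
  | mem w hw =>
    obtain ⟨φ, rfl⟩ := hw
    simp only [exteriorPower.pairingDual_ιMulti_ιMulti]
    refine Continuous.matrix_det (continuous_matrix fun i j => ?_)
    exact (φ j).continuous_of_finiteDimensional.comp (continuous_apply i)
  | zero => simpa using continuous_const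
  | add w₁ w₂ _ _ h₁ h₂ =>
    simp only [map_add, LinearMap.add_apply]
    exact h₁.add h₂
  | smul c w _ h =>
    simp only [map_smul, LinearMap.smul_apply]
    exact h.const_smul c

/-- The alternating form `(v₁, …, v_k) ↦ det (φⱼ(vᵢ))` attached to `φ₁ ∧ ⋯ ∧ φ_k`. -/
def wedgeToAlternating : ⋀[𝕜]^k (Module.Dual 𝕜 V) →ₗ[𝕜] V [⋀^Fin k]→L[𝕜] 𝕜 where
  toFun w :=
    { exteriorPower.alternatingMapLinearEquiv.symm (exteriorPower.pairingDual 𝕜 V k w) with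
      cont := continuous_pairingDual w }
  map_add' w₁ w₂ := by
    ext v
    exact congr($(map_add (exteriorPower.pairingDual 𝕜 V k) w₁ w₂) (exteriorPower.ιMulti 𝕜 k v))
  map_smul' c w := by
    ext v
    exact congr($(map_smul (exteriorPower.pairingDual 𝕜 V k) c w) (exteriorPower.ιMulti 𝕜 k v))

theorem wedgeToAlternating_apply (w : ⋀[𝕜]^k (Module.Dual 𝕜 V)) (v : Fin k → V) :
    wedgeToAlternating w v =
      exteriorPower.pairingDual 𝕜 V k w (exteriorPower.ιMulti 𝕜 k v) := rfl

theorem wedgeToAlternating_ιMulti (φ : Fin k → Module.Dual 𝕜 V) (v : Fin k → V) :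
    wedgeToAlternating (exteriorPower.ιMulti 𝕜 k φ) v =
      Matrix.det (Matrix.of fun i j => φ j (v i)) := by
  rw [wedgeToAlternating_apply, exteriorPower.pairingDual_ιMulti_ιMulti]

section Basis

variable {ι : Type*} [LinearOrder ι] (b : Module.Basis ι 𝕜 V)

/-- The determinant has entries `δ_{I j, J i}`. Distinct increasing multi-indices have distinct
ranges, which forces a zero column. -/
theorem wedgeToAlternating_coord_apply_basis (I J : Fin k ↪o ι) :
    wedgeToAlternating (exteriorPower.ιMulti 𝕜 k fun j => b.coord (I j)) (fun j => b (J j)) =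
      if I = J then 1 else 0 := by
  have h₁ : ∀ i, b.coord i (b i) = 1 := by simp
  have h₀ : ∀ ⦃i j⦄, i ≠ j → b.coord i (b j) = 0 := fun i j h => by
    simp [Finsupp.single_eq_of_ne h]
  rw [wedgeToAlternating_apply]
  split_ifs with h
  · subst h
    exact exteriorPower.pairingDual_apply_apply_eq_one b b.coord h₁ h₀ k I
  · exact exteriorPower.pairingDual_apply_apply_eq_one_zero b b.coord h₀ k I J h

variable [Fintype ι]

theorem sum_smul_wedgeToAlternating (f : V [⋀^Fin k]→L[𝕜] 𝕜) :
    ∑ I : Fin k ↪o ι, f (fun j => b (I j)) •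
      wedgeToAlternating (exteriorPower.ιMulti 𝕜 k fun j => b.coord (I j)) = f := by
  refine alternating_ext_basis b fun J => ?_
  simp [ContinuousAlternatingMap.sum_apply, wedgeToAlternating_coord_apply_basis]

/-- Besides injectivity, this yields the explicit coefficients used later to write a form in a
chart. -/
theorem sum_wedgeToAlternating_smul (w : ⋀[𝕜]^k (Module.Dual 𝕜 V)) :
    ∑ I : Fin k ↪o ι, wedgeToAlternating w (fun j => b (I j)) •
      exteriorPower.ιMulti 𝕜 k (fun j => b.coord (I j)) = w := by
  have hb : Submodule.span 𝕜 (Set.range b.coord) = ⊤ := by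
    rw [← b.coe_dualBasis]
    exact b.dualBasis.span_eq
  have hw : w ∈ Submodule.span 𝕜 (Set.range (exteriorPower.ιMulti_family 𝕜 k b.coord)) := by
    rw [exteriorPower.ιMulti_family_span_of_span 𝕜 hb]
    trivial
  induction hw using Submodule.span_induction with
  | mem w hw =>
    obtain ⟨s, rfl⟩ := hw
    have := wedgeToAlternating_coord_apply_basis b (Set.powersetCard.ofFinEmbEquiv.symm s)
    simp only [exteriorPower.ιMulti_family, Function.comp_def, this]
    simp
  | zero => simp
  | add w₁ w₂ _ _ h₁ h₂ => simp [add_smul, Finset.sum_add_distrib, h₁, h₂]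
  | smul c w _ h => simp [mul_smul, ← Finset.smul_sum, h]

end Basis

variable (𝕜 V k) in
theorem wedgeToAlternating_bijective :
    Function.Bijective (wedgeToAlternating (𝕜 := 𝕜) (V := V) (k := k)) := by
  let b := Module.finBasis 𝕜 V
  refine ⟨fun w₁ w₂ h => ?_, fun f => ⟨∑ I : Fin k ↪o _, f (fun j => b (I j)) •
    exteriorPower.ιMulti 𝕜 k fun j => b.coord (I j), ?_⟩⟩
  · rw [← sum_wedgeToAlternating_smul b w₁, h, sum_wedgeToAlternating_smul b w₂]
  · simpa using sum_smul_wedgeToAlternating b f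

variable (𝕜 V k) in
/-- The canonical isomorphism `⋀ᵏ V* ≃ Altᵏ(V)`. -/
def wedgeEquivAlternating : (⋀[𝕜]^k (Module.Dual 𝕜 V)) ≃ₗ[𝕜] (V [⋀^Fin k]→L[𝕜] 𝕜) :=
  LinearEquiv.ofBijective wedgeToAlternating (wedgeToAlternating_bijective 𝕜 V k)

end Algebra

/-! ### Isomorphisms of sheaves of dependent functions -/

section LocalModuleIso

variable {n : ℕ} {M : Type u} [TopologicalSpace M] [ChartedSpace (Fin n → ℂ) M]
  {T T' : M → Type} [∀ x, AddCommGroup (T x)] [∀ x, Module ℂ (T x)]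
  [∀ x, AddCommGroup (T' x)] [∀ x, Module ℂ (T' x)]

/-- The isomorphism of modules of sections induced by fibrewise isomorphisms. -/
def LocalModule.secEquiv (F : LocalModule n M T) (G : LocalModule n M T')
    (Φ : ∀ x, T x ≃ₗ[ℂ] T' x)
    (h : ∀ (U : Opens M) (s : (x : U) → T x), (fun x : U => Φ x (s x)) ∈ G.sec U ↔ s ∈ F.sec U)
    (U : Opens M) : F.sec U ≃ₗ[holRing n M U] G.sec U where
  toFun s := ⟨fun x => Φ x (s.1 x), (h U s.1).2 s.2⟩
  invFun t := ⟨fun x => (Φ x).symm (t.1 x), (h U _).1 (by simp)⟩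
  map_add' s t := Subtype.ext (funext fun x => (Φ x).map_add (s.1 x) (t.1 x))
  map_smul' f s := Subtype.ext (funext fun x => (Φ x).map_smul (f.1 x) (s.1 x))
  left_inv s := by ext; simp
  right_inv t := by ext; simp

/-- Fibrewise isomorphisms that match the sections of two local modules induce an isomorphism of
sheaves of modules. -/
def LocalModule.isoOfFiberEquiv (F : LocalModule n M T) (G : LocalModule n M T')
    (Φ : ∀ x, T x ≃ₗ[ℂ] T' x)
    (h : ∀ (U : Opens M) (s : (x : U) → T x), (fun x : U => Φ x (s x)) ∈ G.sec U ↔ s ∈ F.sec U) :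
    F.toSheaf ≅ G.toSheaf :=
  (SheafOfModules.fullyFaithfulForget (structureSheaf n M)).preimageIso
    (PresheafOfModules.isoMk
      (fun U => LinearEquiv.toModuleIso (R := (structureSheaf n M).obj.obj U)
        (F.secEquiv G Φ h (unop U)))
      (fun _ _ _ => rfl))

end LocalModuleIso

/-! ### Coordinate frames and holomorphic sections -/

/-- Evaluating a holomorphic alternating form on holomorphic vector fields gives a holomorphic
function. -/
theorem mdifferentiableAt_alternating_apply {k : ℕ} {N H E F : Type*} [TopologicalSpace N]
    [TopologicalSpace H] [ChartedSpace H N] [NormedAddCommGroup E] [NormedSpace ℂ E]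
    {I : ModelWithCorners ℂ E H} [NormedAddCommGroup F] [NormedSpace ℂ F]
    {f : N → F [⋀^Fin k]→L[ℂ] ℂ} {v : Fin k → N → F} {x : N}
    (hf : MDifferentiableAt I 𝓘(ℂ, F [⋀^Fin k]→L[ℂ] ℂ) f x)
    (hv : ∀ j, MDifferentiableAt I 𝓘(ℂ, F) (v j) x) :
    MDifferentiableAt I 𝓘(ℂ, ℂ) (fun y => f y (fun j => v j y)) x := by
  have h : Differentiable ℂ fun q : (F [⋀^Fin k]→L[ℂ] ℂ) × (Fin k → F) => q.1 (fun j => q.2 j) :=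
    differentiable_fst.continuousAlternatingMap_apply fun j =>
      differentiable_pi.1 differentiable_snd j
  have hv' : MDifferentiableAt I 𝓘(ℂ, Fin k → F) (fun y j => v j y) x :=
    ⟨continuousWithinAt_pi.2 fun j => (hv j).1, differentiableWithinAt_pi.2 fun j => (hv j).2⟩
  exact h.comp_mdifferentiableAt (hf.prodMk_space hv')

section Frames

variable {n k : ℕ} {M : Type u} [TopologicalSpace M] [ChartedSpace (Fin n → ℂ) M]

instance (x : M) : T2Space (TangentSpace 𝓘(ℂ, Fin n → ℂ) x) :=
  inferInstanceAs (T2Space (Fin n → ℂ))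

instance (x : M) : FiniteDimensional ℂ (TangentSpace 𝓘(ℂ, Fin n → ℂ) x) :=
  inferInstanceAs (FiniteDimensional ℂ (Fin n → ℂ))

/-- The canonical isomorphism `⋀ᵏ (T_x M)* ≃ Altᵏ(T_x M)`. -/
def fiberEquiv (x : M) : ExtFiber n k M x ≃ₗ[ℂ] AltFiber n k M x :=
  wedgeEquivAlternating ℂ (TangentSpace 𝓘(ℂ, Fin n → ℂ) x) k

theorem fiberEquiv_dzWedge (e : OpenPartialHomeomorph M (Fin n → ℂ)) (I : Fin k ↪o Fin n) (x : M)
    (v : Fin k → TangentSpace 𝓘(ℂ, Fin n → ℂ) x) :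
    fiberEquiv x (dzWedge e I x) v = Matrix.det (Matrix.of fun i j => dz e (I j) x (v i)) :=
  wedgeToAlternating_ιMulti (V := TangentSpace 𝓘(ℂ, Fin n → ℂ) x) _ _

variable [IsManifold 𝓘(ℂ, Fin n → ℂ) ω M]

/-- The coordinate isomorphism `T_x M ≃ ℂⁿ` of a chart `e` at a point `x` of its domain. -/
def chartEquiv (e : atlas (Fin n → ℂ) M) (x : M) (hx : x ∈ e.1.source) :
    TangentSpace 𝓘(ℂ, Fin n → ℂ) x ≃ₗ[ℂ] (Fin n → ℂ) :=
  LinearEquiv.ofLinearMap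
    ((tangentBundleCore 𝓘(ℂ, Fin n → ℂ) M).coordChange (achart _ x) e x).toLinearMap
    ((tangentBundleCore 𝓘(ℂ, Fin n → ℂ) M).coordChange e (achart _ x) x).toLinearMap
    (LinearMap.ext fun v => by
      -- Cocycle identity: going from `e` to the preferred chart at `x` and back is the identity.
      have h := (tangentBundleCore 𝓘(ℂ, Fin n → ℂ) M).coordChange_comp e (achart _ x) e x
        ⟨⟨hx, mem_chart_source _ x⟩, hx⟩ v
      rw [(tangentBundleCore 𝓘(ℂ, Fin n → ℂ) M).coordChange_self e x hx] at h
      exact h)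
    (LinearMap.ext fun v => by
      have h := (tangentBundleCore 𝓘(ℂ, Fin n → ℂ) M).coordChange_comp (achart _ x) e (achart _ x) x
        ⟨⟨mem_chart_source _ x, hx⟩, mem_chart_source _ x⟩ v
      exact h.trans ((tangentBundleCore 𝓘(ℂ, Fin n → ℂ) M).coordChange_self (achart _ x) x
        (mem_chart_source _ x) v))

/-- The coordinate vector fields `∂/∂zⁱ` of a chart `e`, at a point `x` of its domain. -/
def chartBasis (e : atlas (Fin n → ℂ) M) (x : M) (hx : x ∈ e.1.source) :
    Module.Basis (Fin n) ℂ (TangentSpace 𝓘(ℂ, Fin n → ℂ) x) :=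
  (Pi.basisFun ℂ (Fin n)).map (chartEquiv e x hx).symm

theorem chartBasis_apply (e : atlas (Fin n → ℂ) M) (x : M) (hx : x ∈ e.1.source) (i : Fin n) :
    chartBasis e x hx i =
      (tangentBundleCore 𝓘(ℂ, Fin n → ℂ) M).coordChange e (achart _ x) x (Pi.single i 1) := by
  rw [chartBasis, Module.Basis.map_apply, Pi.basisFun_apply]
  rfl

/-- This ties the dual basis of the coordinate fields, defined by bundle cocycles, to the
differentials `dzⁱ`, defined by `mfderiv`. -/
theorem chartBasis_coord (e : atlas (Fin n → ℂ) M) (x : M) (hx : x ∈ e.1.source) (i : Fin n) :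
    (chartBasis e x hx).coord i = dz e.1 i x := by
  have he : MDifferentiableAt 𝓘(ℂ, Fin n → ℂ) 𝓘(ℂ, Fin n → ℂ) e.1 x :=
    mdifferentiableAt_atlas e.2 hx
  have h₁ : mfderiv 𝓘(ℂ, Fin n → ℂ) 𝓘(ℂ, Fin n → ℂ) e.1 x =
      (tangentBundleCore 𝓘(ℂ, Fin n → ℂ) M).coordChange (achart _ x) e x := by
    -- `T_x M` is modelled on `ℂⁿ` through the preferred chart at `x`, so the derivative of `e` is
    -- by definition that of the transition map from this chart to `e`.
    rw [he.mfderiv]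
    rfl
  have h₂ : HasMFDerivAt 𝓘(ℂ, Fin n → ℂ) 𝓘(ℂ, ℂ) (fun y => e.1 y i) x
      ((ContinuousLinearMap.proj (R := ℂ) (φ := fun _ : Fin n => ℂ) i).comp
        (mfderiv 𝓘(ℂ, Fin n → ℂ) 𝓘(ℂ, Fin n → ℂ) e.1 x)) :=
    (ContinuousLinearMap.proj (R := ℂ) (φ := fun _ : Fin n => ℂ) i).hasMFDerivAt.comp x
      he.hasMFDerivAt
  rw [dz, h₂.mfderiv, h₁]
  rfl

/-- The coordinate vector fields of a chart are holomorphic in the trivialization of the tangent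
bundle induced by any other chart. -/
theorem mdifferentiableAt_coordChange_apply (e e' : atlas (Fin n → ℂ) M) (x : M)
    (hx : x ∈ e.1.source) (hx' : x ∈ e'.1.source) (v : Fin n → ℂ) :
    MDifferentiableAt 𝓘(ℂ, Fin n → ℂ) 𝓘(ℂ, Fin n → ℂ)
      (fun y => (tangentBundleCore 𝓘(ℂ, Fin n → ℂ) M).coordChange e e' y v) x := by
  -- Tangent coordinate changes are derivatives of transition maps, so one order of smoothness is
  -- lost.
  have : IsManifold 𝓘(ℂ, Fin n → ℂ) (1 + 1) M := .of_le (n := ω) le_top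
  have hc : (tangentBundleCore 𝓘(ℂ, Fin n → ℂ) M).IsContMDiff 𝓘(ℂ, Fin n → ℂ) 1 :=
    tangentBundleCore.isContMDiff
  have h := (((tangentBundleCore 𝓘(ℂ, Fin n → ℂ) M).contMDiffOn_coordChange 𝓘(ℂ, Fin n → ℂ) e e'
    ).contMDiffAt ((e.1.open_source.inter e'.1.open_source).mem_nhds ⟨hx, hx'⟩)).mdifferentiableAt
      one_ne_zero
  exact h.clm_apply mdifferentiableAt_const

/-- A `k`-covector is determined by its values on the coordinate vector fields. -/
theorem sum_fiberEquiv_smul_dzWedge (e : atlas (Fin n → ℂ) M) (x : M) (hx : x ∈ e.1.source)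
    (w : ExtFiber n k M x) :
    w = ∑ I : Fin k ↪o Fin n, fiberEquiv x w (fun j => chartBasis e x hx (I j)) •
      dzWedge e.1 I x := by
  have h := sum_wedgeToAlternating_smul (V := TangentSpace 𝓘(ℂ, Fin n → ℂ) x) (k := k)
    (chartBasis e x hx) w
  refine h.symm.trans (Finset.sum_congr rfl fun I _ => ?_)
  simp only [chartBasis_coord e x hx]
  rfl

/-- The bundle trivialization pulls forms back along the inverse tangent trivialization; the trivial
target bundle contributes only the identity. -/
theorem trivializationAt_altBundle_apply (x₀ x : M) (hx : x ∈ (chartAt (Fin n → ℂ) x₀).source)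
    (f : AltFiber n k M x) (v : Fin k → Fin n → ℂ) :
    (trivializationAt (AltModel n k) (AltFiber n k M) x₀ ⟨x, f⟩).2 v =
      f (fun j => (tangentBundleCore 𝓘(ℂ, Fin n → ℂ) M).coordChange (achart _ x₀) (achart _ x) x
        (v j)) := by
  rw [← TangentBundle.symmL_trivializationAt_eq_core hx,
    FiberBundle.trivializationAt_continuousAlternatingMap_apply]
  have h : (trivializationAt ℂ (Bundle.Trivial M ℂ) x₀).continuousLinearMapAt ℂ x =
      ContinuousLinearMap.id ℂ ℂ := Bundle.Trivial.continuousLinearMapAt_trivialization ..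
  rw [ContinuousAlternatingMap.inCoordinates, h]
  rfl

theorem IsHolForm.of_isHolSection {U : Opens M} {s : (x : U) → ExtFiber n k M x}
    (hs : IsHolSection (fun x : U => fiberEquiv (x : M) (s x))) : IsHolForm s := by
  intro e he p hp
  let V : Opens M := U ⊓ ⟨e.source, e.open_source⟩
  have hV : V ≤ U := inf_le_left
  refine ⟨V, hV, ⟨p.2, hp⟩, fun x hx => hx.2, fun I =>
    ⟨fun x => fiberEquiv (x : M) (s ⟨x, hV x.2⟩) fun j => chartBasis ⟨e, he⟩ x x.2.2 (I j), ?_⟩,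
    fun x => sum_fiberEquiv_smul_dzWedge ⟨e, he⟩ x x.2.2 _⟩
  intro x₀
  have hA : IsHolSection (fun x : V => fiberEquiv (x : M) (s ⟨x, hV x.2⟩)) :=
    mdifferentiable_restrict hV hs
  -- The preferred chart at `x` may jump with `x`, so the coordinate fields of `e` are expressed in
  -- the fixed chart at `x₀`; the cocycle identity at the end compares the two.
  have hv (j : Fin k) := (mdifferentiableAt_coordChange_apply ⟨e, he⟩ (achart _ (x₀ : M)) x₀ x₀.2.2
    (mem_chart_source _ _) (Pi.single (I j) 1)).comp x₀
      ((contMDiff_subtype_val (n := 1) x₀).mdifferentiableAt one_ne_zero)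
  refine (mdifferentiableAt_alternating_apply ((isHolSection_iff _).1 hA x₀) hv
    ).congr_of_eventuallyEq ?_
  filter_upwards [continuous_subtype_val.continuousAt.eventually_mem
    ((chartAt (Fin n → ℂ) (x₀ : M)).open_source.mem_nhds (mem_chart_source _ _))] with x hx
  rw [trivializationAt_altBundle_apply _ _ hx]
  congr 1
  funext j
  rw [chartBasis_apply]
  exact ((tangentBundleCore 𝓘(ℂ, Fin n → ℂ) M).coordChange_comp ⟨e, he⟩ (achart _ (x₀ : M))
    (achart _ (x : M)) x ⟨⟨x.2.2, hx⟩, mem_chart_source _ _⟩ _).symm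

/-- The form `dz^{i₁} ∧ ⋯ ∧ dz^{i_k}` of a chart is constant in the trivialization that the chart
induces. -/
theorem trivializationAt_dzWedge (x₀ x : M) (hx : x ∈ (chartAt (Fin n → ℂ) x₀).source)
    (I : Fin k ↪o Fin n) :
    (trivializationAt (AltModel n k) (AltFiber n k M) x₀
      ⟨x, fiberEquiv x (dzWedge (chartAt (Fin n → ℂ) x₀) I x)⟩).2 =
      wedgeToAlternating (exteriorPower.ιMulti ℂ k fun j => LinearMap.proj (I j)) := by
  ext v
  refine (trivializationAt_altBundle_apply _ _ hx _ v).trans ((fiberEquiv_dzWedge _ _ _ _).trans ?_)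
  rw [wedgeToAlternating_ιMulti]
  congr 1
  ext i j
  simp only [Matrix.of_apply]
  exact (LinearMap.congr_fun (chartBasis_coord (achart _ x₀) x hx (I j))
    ((chartEquiv (achart _ x₀) x hx).symm (v i))).symm.trans
      (congr_fun ((chartEquiv (achart _ x₀) x hx).apply_symm_apply (v i)) (I j))

theorem IsHolForm.isHolSection {U : Opens M} {s : (x : U) → ExtFiber n k M x}
    (hs : IsHolForm s) : IsHolSection (fun x : U => fiberEquiv (x : M) (s x)) := by
  rw [isHolSection_iff]
  intro x₀
  -- Choosing the preferred chart at `x₀` makes the coordinate frame constant in the very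
  -- trivialization that tests holomorphy at `x₀`.
  obtain ⟨V, hV, hx₀, hVe, f, hf⟩ := hs _ (chart_mem_atlas _ (x₀ : M)) x₀ (mem_chart_source _ _)
  refine (differentiableWithinAt_localInvariantProp.liftPropAt_iff_comp_inclusion hV _
    ⟨x₀.1, hx₀⟩).2 ?_
  have h : MDifferentiable 𝓘(ℂ, Fin n → ℂ) 𝓘(ℂ, AltModel n k) fun x : V =>
      ∑ I, (f I).1 x • wedgeToAlternating (V := Fin n → ℂ)
        (exteriorPower.ιMulti ℂ k fun j => LinearMap.proj (I j)) := by
    intro x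
    have h := MDifferentiableAt.sum (t := Finset.univ) fun I _ => ((f I).2 x).smul
      (mdifferentiableAt_const (c := (wedgeToAlternating (V := Fin n → ℂ)
        (exteriorPower.ιMulti ℂ k fun j => LinearMap.proj (I j)))))
    simpa only [Finset.sum_fn] using! h
  convert! h ⟨x₀.1, hx₀⟩ using 1
  funext x
  have hx := hVe x.2
  have hlin := (trivializationAt (AltModel n k) (AltFiber n k M) (x₀ : M)).linear ℂ
    (show (x : M) ∈ _ from ⟨hx, trivial⟩)
  simp only [Function.comp_apply, ← trivializationAt_dzWedge (x₀ : M) x hx]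
  refine (congrArg (fun w => (trivializationAt (AltModel n k) (AltFiber n k M) (x₀ : M)
    ⟨x, fiberEquiv (x : M) w⟩).2) (hf x)).trans ?_
  -- The trivialization and `fiberEquiv` are linear on the fibre, so both pass through the sum.
  exact (map_sum (hlin.mk'.comp (fiberEquiv (x : M)).toLinearMap) _ _).trans
    (Finset.sum_congr rfl fun I _ => map_smul _ _ _)

end Frames

end HolForms

end

theorem theorem23 (n k : ℕ) (M : Type*) [TopologicalSpace M] [T2Space M]
    [ChartedSpace (Fin n → ℂ) M] [IsManifold 𝓘(ℂ, Fin n → ℂ) ω M] :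
    Nonempty (HolForms.altFormSheaf n k M ≅ HolForms.classicalFormSheaf n k M) :=
  ⟨(HolForms.LocalModule.isoOfFiberEquiv (HolForms.holForms n k M) (HolForms.altForms n k M)
    HolForms.fiberEquiv fun _ _ =>
      ⟨HolForms.IsHolForm.of_isHolSection, HolForms.IsHolForm.isHolSection⟩).symm⟩
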